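/- For an integer $L\ge 1$ let $\mathbb{T}_L^2$ be the two-dimensional discrete torus with vertex set $\{-L+1,\dots,L\}^2$, in which two vertices are adjacent if they agree in one coordinate and differ by exactly $1$ modulo $2L$ in the other; write $\|x-y\|_1$ for the graph distance. For $U:[-1,1]\to(-\infty,\infty]$, the spin $O(2)$ model on $\mathbb{T}_L^2$ with potential $U$ is the probability measure on configurations $\sigma:V(\mathbb{T}_L^2)\to\mathbb{S}^1$ given by $$\frac1Z\exp\Big[-\sum_{\{u,v\}\in E(\mathbb{T}_L^2)}U(\langle\sigma_u,\sigma_v\rangle)\Big]\,d\sigma,$$ where $d\sigma$ is the product over the vertices of the uniform probability measures on $\mathbb{S}^1$, $\exp(-\infty):=0$, and $Z$ is the normalizing constant. Theorem. Let $U:[-1,1]\to(-\infty,\infty]$ be non-increasing, with $U(r)=\infty$ for all $r<\frac1{\sqrt2}$, and with $U(r)<\infty$ for some $r<1$ (this is exactly what makes $Z$ positive, so that the model is well defined). Then, for all integers $1\le\ell\le L$, if $\sigma$ is sampled from the spin $O(2)$ model on $\mathbb{T}_L^2$ with potential $U$, $$\max_{\substack{x,y\in V(\mathbb{T}_L^2)\\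 \|x-y\|_1\ge\ell}}\mathbb{E}\langle\sigma_x,\sigma_y\rangle\ \ge\ \frac1{2\ell^2}.$$ Consequently correlations do not decay exponentially: there are no constants $C\in\mathbb{R}$, $c>0$ such that $\mathbb{E}\langle\sigma_x,\sigma_y\rangle\le C e^{-c\|x-y\|_1}$ for all $L\ge1$ and all $x,y\in V(\mathbb{T}_L^2)$. -/

import Mathlib

open MeasureTheory
open scoped ENNReal

noncomputable section

namespace SpinModel

/-- The unit sphere `S^{n-1}` in `ℝⁿ`. -/
abbrev Sphere (n : ℕ) : Type :=
  Metric.sphere (0 : EuclideanSpace ℝ (Fin n)) 1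

/-- The uniform probability measure on `S^{n-1}`: normalised surface measure. -/
def uniformSphere (n : ℕ) : Measure (Sphere n) :=
  ((volume : Measure (EuclideanSpace ℝ (Fin n))).toSphere Set.univ)⁻¹ •
    (volume : Measure (EuclideanSpace ℝ (Fin n))).toSphere

/-- The inner product of two unit vectors, as an element of `[-1, 1]`. -/
def spinInner {n : ℕ} (a b : Sphere n) : Set.Icc (-1 : ℝ) 1 :=
  ⟨inner ℝ (a : EuclideanSpace ℝ (Fin n)) (b : EuclideanSpace ℝ (Fin n)), by
    have h := abs_real_inner_le_norm (a : EuclideanSpace ℝ (Fin n))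
      (b : EuclideanSpace ℝ (Fin n))
    rw [norm_eq_of_mem_sphere a, norm_eq_of_mem_sphere b, mul_one] at h
    exact abs_le.mp h⟩

theorem spinInner_comm {n : ℕ} (a b : Sphere n) : spinInner a b = spinInner b a :=
  Subtype.ext (real_inner_comm _ _)

/-- `exp (-u)` for `u ∈ (-∞, ∞]`, with `exp (-∞) = 0`. -/
def expNeg : WithTop ℝ → ℝ≥0∞
  | ⊤ => 0
  | (u : ℝ) => ENNReal.ofReal (Real.exp (-u))

/-- The energy `∑_{{u,v} ∈ E(G)} U(⟨σ_u, σ_v⟩)`. The type `WithTop ℝ` is `(-∞, ∞]`. -/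
def energy {V : Type*} [Fintype V] (G : SimpleGraph V) {n : ℕ}
    (U : Set.Icc (-1 : ℝ) 1 → WithTop ℝ) (σ : V → Sphere n) : WithTop ℝ :=
  open Classical in
  ∑ e ∈ G.edgeFinset,
    Sym2.lift ⟨fun u v => U (spinInner (σ u) (σ v)),
      fun u v => congrArg U (spinInner_comm (σ u) (σ v))⟩ e

/-- The partition function of the spin `O(n)` model on `G` with potential `U`. -/
def partitionFunction {V : Type*} [Fintype V] (G : SimpleGraph V) (n : ℕ)
    (U : Set.Icc (-1 : ℝ) 1 → WithTop ℝ) : ℝ≥0∞ :=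
  ∫⁻ σ : V → Sphere n, expNeg (energy G U σ) ∂(Measure.pi fun _ => uniformSphere n)

/-- The spin `O(n)` model on `G` with potential `U`, as a measure on configurations. -/
def spinMeasure {V : Type*} [Fintype V] (G : SimpleGraph V) (n : ℕ)
    (U : Set.Icc (-1 : ℝ) 1 → WithTop ℝ) : Measure (V → Sphere n) :=
  (partitionFunction G n U)⁻¹ •
    (Measure.pi fun _ : V => uniformSphere n).withDensity fun σ => expNeg (energy G U σ)

/-- The correlation `ρ_{x,y} = 𝔼⟨σ_x, σ_y⟩`. -/
def correlation {V : Type*} [Fintype V] (G : SimpleGraph V) (n : ℕ)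
    (U : Set.Icc (-1 : ℝ) 1 → WithTop ℝ) (x y : V) : ℝ :=
  ∫ σ, (spinInner (σ x) (σ y) : ℝ) ∂(spinMeasure G n U)

/-- The vertex set `{-L+1, …, L}^d` of the discrete torus. -/
abbrev TorusVertex (d L : ℕ) : Type :=
  Fin d → Finset.Ioc (-(L : ℤ)) (L : ℤ)

/-- The `d`-dimensional discrete torus of side length `2L`: two vertices are adjacent if they
are equal in all but one coordinate and differ by exactly `1` modulo `2L` in that one. -/
def torus (d L : ℕ) : SimpleGraph (TorusVertex d L) where
  Adj u v := ∃ i, (∀ j, j ≠ i → u j = v j) ∧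
    ((u i : ℤ) - (v i : ℤ) ≡ 1 [ZMOD 2 * (L : ℤ)] ∨
      (v i : ℤ) - (u i : ℤ) ≡ 1 [ZMOD 2 * (L : ℤ)])
  symm := by
    constructor
    rintro u v ⟨i, h, h'⟩
    exact ⟨i, fun j hj => (h j hj).symm, h'.symm⟩
  loopless := by
    constructor
    rintro u ⟨i, -, h⟩
    rw [or_self, sub_self] at h
    obtain ⟨k, hk⟩ := h.dvd
    rw [mul_assoc] at hk
    omega

end SpinModel

end

noncomputable section

namespace SpinModel

/-! Colour a vertex by whether the first coordinate of its spin dominates the second in modulus. By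
the Hex theorem (`exists_hexConn`), either the dominant vertices cross a square of side `n`
horizontally or the others cross it vertically. Exchanging the coordinates preserves the model, so
vertical crossings may be taken dominant too, and a union bound gives some pair of endpoints joined
with probability at least `1 / (2n²)`.

Adjacent spins are at angle at most `π / 4`. Neighbours in the triangulated grid share a torus
neighbour, so their spins are at angle at most `π / 2`, and if both are dominant their first
coordinates almost surely have the same sign. A crossing thus transports the sign
(`mul_pos_of_hexConn`), and the product of the first coordinates at its ends is at least `1 / 2`.
Off the crossing event nothing is lost: given the second coordinates and the moduli of the first
ones, the signs form a ferromagnetic Ising model because `U` is non-increasing, and Griffiths'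
inequality makes the remaining contribution non-negative (`setIntegral_flip_invariant_nonneg`). Both
coordinates contribute equally to the correlation, which is therefore at least the crossing
probability (`measureReal_le_correlation`).

Cutting the corners leaves `n` endpoints per side instead of `n + 1`, with opposite sides still at
distance `n`; this yields the exact constant. -/

/-! ### Crossings of a triangulated square -/

/-- The directed edges of the triangulated grid: right, up and along the main diagonal. -/
def HexEdge (p q : ℕ × ℕ) : Prop :=
  q = (p.1 + 1, p.2) ∨ q = (p.1, p.2 + 1) ∨ q = (p.1 + 1, p.2 + 1)

/-- A step of the triangulated square `[0, n]²` between two points of colour `c`. -/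
def HexStep (n : ℕ) (c : ℕ × ℕ → Prop) (p q : ℕ × ℕ) : Prop :=
  (HexEdge p q ∨ HexEdge q p) ∧ p ≤ (n, n) ∧ q ≤ (n, n) ∧ c p ∧ c q

/-- `p` and `q` are joined by a path of colour `c` in the triangulated square `[0, n]²`. -/
def HexConn (n : ℕ) (c : ℕ × ℕ → Prop) (p q : ℕ × ℕ) : Prop :=
  c p ∧ Relation.ReflTransGen (HexStep n c) p q

theorem HexConn.right {n : ℕ} {c : ℕ × ℕ → Prop} {p q : ℕ × ℕ} (h : HexConn n c p q) : c q := by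
  obtain ⟨hp, h⟩ := h
  cases h with
  | refl => exact hp
  | tail _ h => exact h.2.2.2.2

theorem HexConn.tail {n : ℕ} {c : ℕ × ℕ → Prop} {p q r : ℕ × ℕ} (h : HexConn n c p q)
    (h' : HexStep n c q r) : HexConn n c p r :=
  ⟨h.1, h.2.tail h'⟩

theorem HexConn.head {n : ℕ} {c : ℕ × ℕ → Prop} {p q r : ℕ × ℕ} (h : HexConn n c q r)
    (h' : HexStep n c p q) : HexConn n c p r :=
  ⟨h'.2.2.2.1, h.2.head h'⟩

theorem HexConn.mono {n : ℕ} {c c' : ℕ × ℕ → Prop} (hc : ∀ p, c p → c' p) {p q : ℕ × ℕ}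
    (h : HexConn n c p q) : HexConn n c' p q :=
  ⟨hc _ h.1, Relation.ReflTransGen.mono (fun _ _ h =>
    ⟨h.1, h.2.1, h.2.2.1, hc _ h.2.2.2.1, hc _ h.2.2.2.2⟩) _ _ h.2⟩

/-- Discrete Green formula on a rectangle, for a closed `1`-form. -/
theorem sum_boundary_of_closed {M : Type*} [AddCommGroup M] (H K : ℕ → ℕ → M) (n m : ℕ)
    (h : ∀ i < n, ∀ j < m, H i j + K (i + 1) j = K i j + H i (j + 1)) :
    ∑ i ∈ Finset.range n, H i 0 + ∑ j ∈ Finset.range m, K n j =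
      ∑ j ∈ Finset.range m, K 0 j + ∑ i ∈ Finset.range n, H i m := by
  have row : ∀ j < m, ∑ i ∈ Finset.range n, H i j + K n j =
      K 0 j + ∑ i ∈ Finset.range n, H i (j + 1) := by
    intro j hj
    have : ∀ k ≤ n, ∑ i ∈ Finset.range k, H i j + K k j =
        K 0 j + ∑ i ∈ Finset.range k, H i (j + 1) := by
      intro k
      induction k with
      | zero => simp
      | succ k ih =>
        intro hk
        rw [Finset.sum_range_succ, Finset.sum_range_succ, add_assoc, h k hk j hj, ← add_assoc,
          ih (by omega), add_assoc]
    exact this n le_rfl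
  have : ∀ k ≤ m, ∑ i ∈ Finset.range n, H i 0 + ∑ j ∈ Finset.range k, K n j =
      ∑ j ∈ Finset.range k, K 0 j + ∑ i ∈ Finset.range n, H i k := by
    intro k
    induction k with
    | zero => simp
    | succ k ih =>
      intro hk
      rw [Finset.sum_range_succ, Finset.sum_range_succ, ← add_assoc, ih (by omega), add_assoc,
        row k hk, add_assoc]
  exact this m le_rfl

/-- The indicator in `ZMod 2` of the edges of a four-cycle of labels joining the labels
`(true, true)` and `(false, true)`. -/
def labelForm (x y : Bool × Bool) : ZMod 2 :=
  if (x = (true, true) ∧ y = (false, true)) ∨ (x = (false, true) ∧ y = (true, true)) then 1 else 0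

/-- Two vertices of a triangle share a colour, hence a label, so the triangle collapses onto one
edge or vertex of the four-cycle and the form is closed. -/
theorem labelForm_add (x y z : Bool × Bool) (hxy : x.1 = y.1 → x = y) (hyz : y.1 = z.1 → y = z)
    (hxz : x.1 = z.1 → x = z) : labelForm x y + labelForm y z = labelForm x z := by
  revert x y z
  decide

/-- A labelling of the triangulated square by a four-cycle cannot wind around the cycle along
the boundary. -/
theorem not_winding_labelling (n : ℕ) (l : ℕ × ℕ → Bool × Bool)
    (hl : ∀ p q, HexEdge p q → p ≤ (n, n) → q ≤ (n, n) → (l p).1 = (l q).1 → l p = l q)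
    (hL : ∀ j ≤ n, l (0, j) ≠ (true, false)) (hR : ∀ j ≤ n, l (n, j) ≠ (true, true))
    (hB : ∀ i ≤ n, l (i, 0) ≠ (false, false)) (hT : ∀ i ≤ n, l (i, n) ≠ (false, true)) :
    False := by
  have le : ∀ i j, i ≤ n → j ≤ n → ((i, j) : ℕ × ℕ) ≤ (n, n) := fun i j hi hj => ⟨hi, hj⟩
  have tri : ∀ p q s, HexEdge p q → HexEdge q s → HexEdge p s → p ≤ (n, n) → q ≤ (n, n) →
      s ≤ (n, n) → labelForm (l p) (l q) + labelForm (l q) (l s) = labelForm (l p) (l s) :=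
    fun p q s hpq hqs hps hp hq hs =>
      labelForm_add _ _ _ (hl _ _ hpq hp hq) (hl _ _ hqs hq hs) (hl _ _ hps hp hs)
  have key := sum_boundary_of_closed (fun i j => labelForm (l (i, j)) (l (i + 1, j)))
    (fun i j => labelForm (l (i, j)) (l (i, j + 1))) n n (by
      intro i hi j hj
      rw [tri (i, j) (i + 1, j) (i + 1, j + 1) (by simp [HexEdge]) (by simp [HexEdge])
          (by simp [HexEdge]) (le _ _ hi.le hj.le) (le _ _ hi hj.le) (le _ _ hi hj),
        tri (i, j) (i, j + 1) (i + 1, j + 1) (by simp [HexEdge]) (by simp [HexEdge])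
          (by simp [HexEdge]) (le _ _ hi.le hj.le) (le _ _ hi.le hj) (le _ _ hi hj)])
  -- The label avoided on the right or top side is an end of the counted edge, so the form vanishes
  -- there. On the left and bottom sides the avoided label opens the cycle into a path, where the
  -- form is a coboundary and telescopes.
  have h1 : ∑ j ∈ Finset.range n, labelForm (l (n, j)) (l (n, j + 1)) = 0 := by
    refine Finset.sum_eq_zero fun j hj => ?_
    have hj := Finset.mem_range.1 hj
    simp [labelForm, hR j hj.le, hR (j + 1) hj]
  have h2 : ∑ i ∈ Finset.range n, labelForm (l (i, n)) (l (i + 1, n)) = 0 := by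
    refine Finset.sum_eq_zero fun i hi => ?_
    have hi := Finset.mem_range.1 hi
    simp [labelForm, hT i hi.le, hT (i + 1) hi]
  have h3 : ∑ j ∈ Finset.range n, labelForm (l (0, j)) (l (0, j + 1)) =
      (if l (0, n) = (false, true) then 1 else 0) -
        (if l (0, 0) = (false, true) then 1 else 0) := by
    rw [← Finset.sum_range_sub (fun j => if l (0, j) = (false, true) then (1 : ZMod 2) else 0)]
    refine Finset.sum_congr rfl fun j hj => ?_
    have hj := Finset.mem_range.1 hj
    have e1 := hL j hj.le
    have e2 := hL (j + 1) hj
    have e3 := hl (0, j) (0, j + 1) (by simp [HexEdge]) (le _ _ (by omega) hj.le)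
      (le _ _ (by omega) hj)
    generalize l (0, j) = x at *
    generalize l (0, j + 1) = y at *
    revert x y
    decide
  have h4 : ∑ i ∈ Finset.range n, labelForm (l (i, 0)) (l (i + 1, 0)) =
      (if l (n, 0) = (true, true) then 1 else 0) -
        (if l (0, 0) = (true, true) then 1 else 0) := by
    rw [← Finset.sum_range_sub (fun i => if l (i, 0) = (true, true) then (1 : ZMod 2) else 0)]
    refine Finset.sum_congr rfl fun j hj => ?_
    have hj := Finset.mem_range.1 hj
    have e1 := hB j hj.le
    have e2 := hB (j + 1) hj
    have e3 := hl (j, 0) (j + 1, 0) (by simp [HexEdge]) (le _ _ hj.le (by omega))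
      (le _ _ hj (by omega))
    generalize l (j, 0) = x at *
    generalize l (j + 1, 0) = y at *
    revert x y
    decide
  -- What remains equates two indicators at the corner `(0, 0)`, of which exactly one equals `1`.
  rw [h1, h2, h3, h4, if_neg (hR 0 (by omega)), if_neg (hT 0 (by omega))] at key
  have e1 := hL 0 (by omega)
  have e2 := hB 0 (by omega)
  clear h1 h2 h3 h4
  generalize l (0, 0) = x at *
  revert x
  decide

/-- The Hex theorem: a two-coloured triangulated square has a horizontal crossing in one colour
or a vertical crossing in the other one. -/
theorem exists_hexConn (n : ℕ) (c : ℕ × ℕ → Prop) :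
    (∃ j ≤ n, ∃ j' ≤ n, HexConn n c (0, j) (n, j')) ∨
      ∃ i ≤ n, ∃ i' ≤ n, HexConn n (fun p => ¬ c p) (i, 0) (i', n) := by
  classical
  by_contra! hcon
  obtain ⟨hL, hB⟩ := hcon
  -- The second component records being reached within the own colour from its starting side: left
  -- for `c`, bottom for `¬ c`. Without crossings, reached labels stay away from the opposite sides.
  let l : ℕ × ℕ → Bool × Bool := fun p => (decide (c p), decide
    ((∃ j ≤ n, HexConn n c (0, j) p) ∨ ∃ i ≤ n, HexConn n (fun p => ¬ c p) (i, 0) p))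
  refine not_winding_labelling n l ?_ ?_ ?_ ?_ ?_
  · intro p q h hp hq hc
    refine Prod.ext hc ?_
    have hc : c p ↔ c q := decide_eq_decide.1 hc
    refine decide_eq_decide.2 ⟨?_, ?_⟩
    · rintro (⟨j, hj, h'⟩ | ⟨j, hj, h'⟩)
      · exact .inl ⟨j, hj, h'.tail ⟨.inl h, hp, hq, h'.right, hc.1 h'.right⟩⟩
      · exact .inr ⟨j, hj, h'.tail ⟨.inl h, hp, hq, h'.right, mt hc.2 h'.right⟩⟩
    · rintro (⟨j, hj, h'⟩ | ⟨j, hj, h'⟩)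
      · exact .inl ⟨j, hj, h'.tail ⟨.inr h, hq, hp, h'.right, hc.2 h'.right⟩⟩
      · exact .inr ⟨j, hj, h'.tail ⟨.inr h, hq, hp, h'.right, mt hc.1 h'.right⟩⟩
  · intro j hj h
    simp only [l, Prod.mk.injEq, decide_eq_true_eq, decide_eq_false_iff_not] at h
    exact h.2 (.inl ⟨j, hj, h.1, .refl⟩)
  · intro j hj h
    simp only [l, Prod.mk.injEq, decide_eq_true_eq] at h
    obtain ⟨hc, ⟨j', hj', h⟩ | ⟨i, hi, h⟩⟩ := h
    · exact hL j' hj' j hj h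
    · exact h.right hc
  · intro i hi h
    simp only [l, Prod.mk.injEq, decide_eq_false_iff_not] at h
    exact h.2 (.inr ⟨i, hi, h.1, .refl⟩)
  · intro i hi h
    simp only [l, Prod.mk.injEq, decide_eq_true_eq, decide_eq_false_iff_not] at h
    obtain ⟨hc, ⟨j', hj', h⟩ | ⟨i', hi', h⟩⟩ := h
    · exact hc h.right
    · exact hB i' hi' i hi h

/-! ### Geometry of the torus -/

/-- The vertex of the two-dimensional torus with coordinates `p`, truncated at `L`. -/
def gridVertex {L : ℕ} (hL : 1 ≤ L) (p : ℕ × ℕ) : TorusVertex 2 L :=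
  ![⟨(min p.1 L : ℕ), by rw [Finset.mem_Ioc]; omega⟩,
    ⟨(min p.2 L : ℕ), by rw [Finset.mem_Ioc]; omega⟩]

theorem gridVertex_adj_right {L : ℕ} (hL : 1 ≤ L) {i j : ℕ} (hi : i + 1 ≤ L) :
    (torus 2 L).Adj (gridVertex hL (i, j)) (gridVertex hL (i + 1, j)) := by
  refine ⟨0, fun k hk => ?_, .inr ?_⟩
  · obtain rfl : k = 1 := by omega
    rfl
  · have h1 : min i L = i := by omega
    have h2 : min (i + 1) L = i + 1 := by omega
    simp [gridVertex, h1, h2, Int.ModEq]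

theorem gridVertex_adj_up {L : ℕ} (hL : 1 ≤ L) {i j : ℕ} (hj : j + 1 ≤ L) :
    (torus 2 L).Adj (gridVertex hL (i, j)) (gridVertex hL (i, j + 1)) := by
  refine ⟨1, fun k hk => ?_, .inr ?_⟩
  · obtain rfl : k = 0 := by omega
    rfl
  · have h1 : min j L = j := by omega
    have h2 : min (j + 1) L = j + 1 := by omega
    simp [gridVertex, h1, h2, Int.ModEq]

theorem gridVertex_reachable {L : ℕ} (hL : 1 ≤ L) (p q : ℕ × ℕ) (hp : p ≤ (L, L))
    (hq : q ≤ (L, L)) : (torus 2 L).Reachable (gridVertex hL p) (gridVertex hL q) := by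
  have h1 : ∀ i ≤ L, (torus 2 L).Reachable (gridVertex hL (0, 0)) (gridVertex hL (i, 0)) := by
    intro i
    induction i with
    | zero => exact fun _ => .rfl
    | succ i ih => exact fun hi => (ih (by omega)).trans (gridVertex_adj_right hL hi).reachable
  have h2 : ∀ i ≤ L, ∀ j ≤ L,
      (torus 2 L).Reachable (gridVertex hL (0, 0)) (gridVertex hL (i, j)) := by
    intro i hi j
    induction j with
    | zero => exact fun _ => h1 i hi
    | succ j ih => exact fun hj => (ih (by omega)).trans (gridVertex_adj_up hL hj).reachable
  exact (h2 _ hp.1 _ hp.2).symm.trans (h2 _ hq.1 _ hq.2)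

/-- The distance from `t` to `0` modulo `2L`, for `|t| ≤ 2L`. -/
def cyclicNorm (L : ℕ) (t : ℤ) : ℤ := min |t| (2 * L - |t|)

theorem cyclicNorm_le (L : ℕ) {a b x : ℤ} (ha : a ∈ Finset.Ioc (-(L : ℤ)) L)
    (hb : b ∈ Finset.Ioc (-(L : ℤ)) L) (hx : 0 ≤ x ∧ x ≤ L)
    (h : a - b ≡ 1 [ZMOD 2 * (L : ℤ)] ∨ b - a ≡ 1 [ZMOD 2 * (L : ℤ)]) :
    cyclicNorm L (b - x) ≤ cyclicNorm L (a - x) + 1 := by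
  rw [Finset.mem_Ioc] at ha hb
  -- As `a` and `b` differ by less than `2L`, the congruence allows at most one wrap-around.
  have key : ∃ k : ℤ, (k = -1 ∨ k = 0 ∨ k = 1) ∧
      (a - b = 1 + 2 * L * k ∨ a - b = -1 + 2 * L * k) := by
    have bound : ∀ k : ℤ, -(2 * L : ℤ) ≤ 2 * L * k → 2 * L * k ≤ (2 * L : ℤ) → 1 ≤ (L : ℤ) →
        k = -1 ∨ k = 0 ∨ k = 1 := by
      intro k h1 h2 hL
      have h3 : -1 ≤ k := by nlinarith
      have h4 : k ≤ 1 := by nlinarith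
      omega
    rcases h with h | h
    · obtain ⟨k, hk⟩ := h.symm.dvd
      exact ⟨k, bound k (by omega) (by omega) (by omega), .inl (by omega)⟩
    · obtain ⟨k, hk⟩ := h.symm.dvd
      rcases bound k (by omega) (by omega) (by omega) with rfl | rfl | rfl
      · exact ⟨1, by simp, .inr (by omega)⟩
      · exact ⟨0, by simp, .inr (by omega)⟩
      · exact ⟨-1, by simp, .inr (by omega)⟩
  simp only [cyclicNorm, abs_eq_max_neg]
  obtain ⟨k, rfl | rfl | rfl, hk⟩ := key <;> omega

/-- The cyclic `ℓ¹`-norm relative to `p` grows by at most one along each edge. Coordinates in `[0,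
L]` differ by at most half the circumference, so at `q` it equals the grid distance. -/
theorem le_torus_dist {L : ℕ} (hL : 1 ≤ L) (p q : ℕ × ℕ) (hp : p ≤ (L, L)) (hq : q ≤ (L, L)) :
    |(q.1 : ℤ) - p.1| + |(q.2 : ℤ) - p.2| ≤
      (torus 2 L).dist (gridVertex hL p) (gridVertex hL q) := by
  let N : TorusVertex 2 L → ℤ := fun u =>
    cyclicNorm L ((u 0 : ℤ) - p.1) + cyclicNorm L ((u 1 : ℤ) - p.2)
  have hp1 : (0 : ℤ) ≤ p.1 ∧ (p.1 : ℤ) ≤ L := ⟨by omega, by exact_mod_cast hp.1⟩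
  have hp2 : (0 : ℤ) ≤ p.2 ∧ (p.2 : ℤ) ≤ L := ⟨by omega, by exact_mod_cast hp.2⟩
  have hq1 : (q.1 : ℤ) ≤ L := by exact_mod_cast hq.1
  have hq2 : (q.2 : ℤ) ≤ L := by exact_mod_cast hq.2
  have step : ∀ u v, (torus 2 L).Adj u v → N v ≤ N u + 1 := by
    rintro u v ⟨i, hi, h⟩
    fin_cases i
    · have h1 : u 1 = v 1 := hi 1 (by simp)
      have := cyclicNorm_le L (u 0).2 (v 0).2 hp1 h
      simp only [N, h1]
      omega
    · have h1 : u 0 = v 0 := hi 0 (by simp)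
      have := cyclicNorm_le L (u 1).2 (v 1).2 hp2 h
      simp only [N, h1]
      omega
  have walk : ∀ u v (w : (torus 2 L).Walk u v), N v ≤ N u + w.length := by
    intro u v w
    induction w with
    | nil => simp
    | cons h w ih =>
      have := step _ _ h
      rw [SimpleGraph.Walk.length_cons]
      push_cast
      omega
  obtain ⟨w, hw⟩ := (gridVertex_reachable hL p q hp hq).exists_walk_length_eq_dist
  have := walk _ _ w
  rw [hw] at this
  simp only [N, gridVertex, cyclicNorm, Matrix.cons_val_zero, Matrix.cons_val_one] at this
  have e1 : min p.1 L = p.1 := min_eq_left hp.1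
  have e2 : min p.2 L = p.2 := min_eq_left hp.2
  have e3 : min q.1 L = q.1 := min_eq_left hq.1
  have e4 : min q.2 L = q.2 := min_eq_left hq.2
  simp only [e1, e2, e3, e4, abs_eq_max_neg] at this
  simp only [gridVertex, e1, e2, e3, e4, abs_eq_max_neg]
  omega

/-- Grid points at sup-distance at most `1` have a common neighbour, up to equality. -/
theorem exists_common_neighbour {L : ℕ} (hL : 1 ≤ L) (p q : ℕ × ℕ) (hp : p ≤ (L, L))
    (hq : q ≤ (L, L)) (h1 : p.1 ≤ q.1 + 1) (h2 : q.1 ≤ p.1 + 1) (h3 : p.2 ≤ q.2 + 1)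
    (h4 : q.2 ≤ p.2 + 1) :
    ∃ w, (gridVertex hL p = w ∨ (torus 2 L).Adj (gridVertex hL p) w) ∧
      (w = gridVertex hL q ∨ (torus 2 L).Adj w (gridVertex hL q)) := by
  obtain ⟨p1, p2⟩ := p
  obtain ⟨q1, q2⟩ := q
  have hp1 : p1 ≤ L := hp.1
  have hp2 : p2 ≤ L := hp.2
  have hq1 : q1 ≤ L := hq.1
  have hq2 : q2 ≤ L := hq.2
  simp only at h1 h2 h3 h4
  refine ⟨gridVertex hL (q1, p2), ?_, ?_⟩
  · obtain rfl | rfl | rfl : p1 = q1 ∨ q1 = p1 + 1 ∨ p1 = q1 + 1 := by omega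
    · exact .inl rfl
    · exact .inr (gridVertex_adj_right hL hq1)
    · exact .inr (gridVertex_adj_right hL hp1).symm
  · obtain rfl | rfl | rfl : p2 = q2 ∨ q2 = p2 + 1 ∨ p2 = q2 + 1 := by omega
    · exact .inl rfl
    · exact .inr (gridVertex_adj_up hL hq2)
    · exact .inr (gridVertex_adj_up hL hp2).symm

/-- The retraction of the square `[0, n]²` that moves each corner to the next boundary point in
the pinwheel order. -/
def cutCorner (n : ℕ) (p : ℕ × ℕ) : ℕ × ℕ :=
  if p = (0, 0) then (0, 1) else if p = (0, n) then (1, n) else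
    if p = (n, n) then (n, n - 1) else if p = (n, 0) then (n - 1, 0) else p

theorem cutCorner_le {n : ℕ} (hn : 1 ≤ n) {p : ℕ × ℕ} (hp : p ≤ (n, n)) :
    cutCorner n p ≤ (n, n) := by
  unfold cutCorner
  split_ifs <;> first | exact hp | exact ⟨by simp; try omega, by simp; try omega⟩

theorem cutCorner_near {n : ℕ} (hn : 2 ≤ n) {p q : ℕ × ℕ} (hp : p ≤ (n, n)) (hq : q ≤ (n, n))
    (h : HexEdge p q) :
    (cutCorner n p).1 ≤ (cutCorner n q).1 + 1 ∧ (cutCorner n q).1 ≤ (cutCorner n p).1 + 1 ∧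
      (cutCorner n p).2 ≤ (cutCorner n q).2 + 1 ∧ (cutCorner n q).2 ≤ (cutCorner n p).2 + 1 := by
  obtain ⟨p1, p2⟩ := p
  obtain ⟨q1, q2⟩ := q
  simp only [HexEdge, Prod.mk.injEq, Prod.mk_le_mk] at h hp hq
  unfold cutCorner
  simp only [Prod.mk.injEq]
  split_ifs <;> simp only <;> omega

/-- The left and right sides of the square with its corners cut off are far apart. -/
theorem cutCorner_left_right {n : ℕ} (hn : 2 ≤ n) {j j' : ℕ} (h1 : 1 ≤ j)
    (hj' : j' < n) :
    (n : ℤ) ≤ |((cutCorner n (n, j')).1 : ℤ) - (cutCorner n (0, j)).1| +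
      |((cutCorner n (n, j')).2 : ℤ) - (cutCorner n (0, j)).2| := by
  simp only [cutCorner, Prod.mk.injEq, abs_eq_max_neg]
  split_ifs <;> simp only <;> omega

/-- The bottom and top sides of the square with its corners cut off are far apart. -/
theorem cutCorner_bottom_top {n : ℕ} (hn : 2 ≤ n) {i i' : ℕ} (hi : i < n) (h1 : 1 ≤ i') :
    (n : ℤ) ≤ |((cutCorner n (i', n)).1 : ℤ) - (cutCorner n (i, 0)).1| +
      |((cutCorner n (i', n)).2 : ℤ) - (cutCorner n (i, 0)).2| := by
  simp only [cutCorner, Prod.mk.injEq, abs_eq_max_neg]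
  split_ifs <;> simp only <;> omega

/-- The Hex theorem for the square with its corners cut off. -/
theorem exists_hexConn_cutCorner {n : ℕ} (hn : 2 ≤ n) (c : ℕ × ℕ → Prop) :
    (∃ j < n, ∃ j' < n, HexConn n (fun p => c (cutCorner n p)) (0, j + 1) (n, j')) ∨
      ∃ i < n, ∃ i' < n, HexConn n (fun p => ¬ c (cutCorner n p)) (i, 0) (i' + 1, n) := by
  -- A corner has the pulled-back colour of the next boundary point, so a crossing that starts or
  -- ends at that corner can be extended by one step. Each side thereby drops one of its two corners
  -- as an endpoint.
  have c1 : cutCorner n (0, 0) = cutCorner n (0, 1) := by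
    simp only [cutCorner, Prod.mk.injEq]
    split_ifs <;> apply Prod.ext <;> simp only <;> omega
  have c2 : cutCorner n (n, n) = cutCorner n (n, n - 1) := by
    simp only [cutCorner, Prod.mk.injEq]
    split_ifs <;> apply Prod.ext <;> simp only <;> omega
  have c3 : cutCorner n (0, n) = cutCorner n (1, n) := by
    simp only [cutCorner, Prod.mk.injEq]
    split_ifs <;> apply Prod.ext <;> simp only <;> omega
  have c4 : cutCorner n (n, 0) = cutCorner n (n - 1, 0) := by
    simp only [cutCorner, Prod.mk.injEq]
    split_ifs <;> apply Prod.ext <;> simp only <;> omega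
  rcases exists_hexConn n fun p => c (cutCorner n p) with ⟨j, hj, j', hj', h⟩ | ⟨j, hj, j', hj', h⟩
  · left
    obtain ⟨k, hk, h⟩ : ∃ k < n, HexConn n (fun p => c (cutCorner n p)) (0, k + 1) (n, j') := by
      rcases Nat.eq_zero_or_pos j with rfl | hj0
      · refine ⟨0, by omega, h.head ⟨.inr ?_, ?_, ?_, (congrArg c c1).mp h.1, h.1⟩⟩
        · simp [HexEdge]
        · exact ⟨by simp, by simp; omega⟩
        · exact ⟨by simp, by simp⟩
      · exact ⟨j - 1, by omega, by rwa [Nat.sub_add_cancel hj0]⟩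
    refine ⟨k, hk, ?_⟩
    rcases hj'.eq_or_lt with rfl | hj'
    · refine ⟨j' - 1, by omega, h.tail ⟨.inr ?_, ?_, ?_, h.right, (congrArg c c2).mp h.right⟩⟩
      · simp [HexEdge]; omega
      · exact ⟨by simp, by simp⟩
      · exact ⟨by simp, by simp⟩
    · exact ⟨j', hj', h⟩
  · right
    obtain ⟨k, hk, h⟩ : ∃ k < n, HexConn n (fun p => ¬ c (cutCorner n p)) (k, 0) (j', n) := by
      rcases hj.eq_or_lt with rfl | hj
      · refine ⟨j - 1, by omega, h.head ⟨.inl ?_, ?_, ?_, (congrArg (¬ c ·) c4).mp h.1, h.1⟩⟩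
        · simp [HexEdge]; omega
        · exact ⟨by simp, by simp⟩
        · exact ⟨by simp, by simp⟩
      · exact ⟨j, hj, h⟩
    refine ⟨k, hk, ?_⟩
    rcases Nat.eq_zero_or_pos j' with rfl | hj0
    · refine ⟨0, by omega, h.tail ⟨.inl ?_, ?_, ?_, h.right, (congrArg (¬ c ·) c3).mp h.right⟩⟩
      · simp [HexEdge]
      · exact ⟨by simp, by simp⟩
      · exact ⟨by simp; omega, by simp⟩
    · exact ⟨j' - 1, by omega, by rwa [Nat.sub_add_cancel hj0]⟩

/-! ### The uniform measure on the circle -/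

/-- The action of a linear isometry on the sphere. -/
def sphereMap {n : ℕ} (e : EuclideanSpace ℝ (Fin n) ≃ₗᵢ[ℝ] EuclideanSpace ℝ (Fin n))
    (x : Sphere n) : Sphere n :=
  ⟨e x, by simp⟩

theorem continuous_sphereMap {n : ℕ}
    (e : EuclideanSpace ℝ (Fin n) ≃ₗᵢ[ℝ] EuclideanSpace ℝ (Fin n)) : Continuous (sphereMap e) :=
  Continuous.subtype_mk (e.continuous.comp continuous_subtype_val) _

-- Up to a constant, `toSphere` measures a set by the volume of the cone over it, and an isometry
-- carries cones to cones.
open scoped Pointwise in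
theorem measurePreserving_sphereMap {n : ℕ}
    (e : EuclideanSpace ℝ (Fin n) ≃ₗᵢ[ℝ] EuclideanSpace ℝ (Fin n)) :
    MeasurePreserving (sphereMap e) (uniformSphere n) (uniformSphere n) := by
  refine ⟨(continuous_sphereMap e).measurable, ?_⟩
  ext s hs
  have hm := (continuous_sphereMap e).measurable
  rw [Measure.map_apply hm hs, uniformSphere, Measure.smul_apply, Measure.smul_apply,
    Measure.toSphere_apply' _ (hm hs), Measure.toSphere_apply' _ hs]
  congr 2
  have : Set.Ioo (0 : ℝ) 1 • ((↑) '' (sphereMap e ⁻¹' s) : Set (EuclideanSpace ℝ (Fin n))) =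
      e ⁻¹' (Set.Ioo (0 : ℝ) 1 • ((↑) '' s)) := by
    ext z
    constructor
    · rintro ⟨t, ht, _, ⟨x, hx, rfl⟩, rfl⟩
      exact ⟨t, ht, _, ⟨_, hx, rfl⟩, by simp [sphereMap]⟩
    · rintro ⟨t, ht, _, ⟨x, hx, rfl⟩, hz⟩
      refine ⟨t, ht, _, ⟨sphereMap e.symm x, ?_, rfl⟩, ?_⟩
      · have : sphereMap e (sphereMap e.symm x) = x := Subtype.ext (by simp [sphereMap])
        rwa [Set.mem_preimage, this]
      · apply e.injective
        rw [← hz]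
        simp [sphereMap]
  rw [this]
  exact e.measurePreserving.measure_preimage_equiv (f := e.toMeasurableEquiv) _

instance : IsProbabilityMeasure (uniformSphere 2) := by
  constructor
  rw [uniformSphere, Measure.smul_apply, smul_eq_mul]
  exact ENNReal.inv_mul_cancel (Measure.measure_univ_ne_zero.2 (Measure.toSphere_ne_zero _))
    (measure_ne_top _ _)

-- The cone over this set lies in two lines. Hence ties between the coordinates are negligible and
-- dominance is almost surely strict.
open scoped Pointwise in
theorem uniformSphere_diagonal :
    uniformSphere 2 {x | (x : EuclideanSpace ℝ (Fin 2)) 0 ^ 2 =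
      (x : EuclideanSpace ℝ (Fin 2)) 1 ^ 2} = 0 := by
  have hm : MeasurableSet {x : Sphere 2 | (x : EuclideanSpace ℝ (Fin 2)) 0 ^ 2 =
      (x : EuclideanSpace ℝ (Fin 2)) 1 ^ 2} :=
    (isClosed_eq (by fun_prop) (by fun_prop)).measurableSet
  rw [uniformSphere, Measure.smul_apply, Measure.toSphere_apply' _ hm]
  let l : Fin 2 → EuclideanSpace ℝ (Fin 2) →ₗ[ℝ] ℝ :=
    ![(EuclideanSpace.proj 0 - EuclideanSpace.proj 1 : EuclideanSpace ℝ (Fin 2) →L[ℝ] ℝ),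
      (EuclideanSpace.proj 0 + EuclideanSpace.proj 1 : EuclideanSpace ℝ (Fin 2) →L[ℝ] ℝ)]
  have h0 : ∀ i, (volume : Measure (EuclideanSpace ℝ (Fin 2))) (LinearMap.ker (l i)) = 0 := by
    intro i
    apply Measure.addHaar_submodule
    intro h
    have : EuclideanSpace.single 0 (1 : ℝ) ∈ LinearMap.ker (l i) := h ▸ Submodule.mem_top
    fin_cases i <;> simp [l] at this
  have hsub : Set.Ioo (0 : ℝ) 1 • ((↑) '' {x : Sphere 2 | (x : EuclideanSpace ℝ (Fin 2)) 0 ^ 2 =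
      (x : EuclideanSpace ℝ (Fin 2)) 1 ^ 2} : Set (EuclideanSpace ℝ (Fin 2))) ⊆
      ((LinearMap.ker (l 0) : Submodule ℝ _) : Set (EuclideanSpace ℝ (Fin 2))) ∪
        (LinearMap.ker (l 1) : Submodule ℝ _) := by
    rintro _ ⟨t, ht, _, ⟨x, hx, rfl⟩, rfl⟩
    rcases sq_eq_sq_iff_eq_or_eq_neg.1 hx with h | h
    · left; simp [l, h]
    · right; simp [l, h]
  rw [measure_mono_null hsub (measure_union_null (h0 0) (h0 1))]
  simp

/-- The exchange of the two coordinates of the circle. -/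
def swapCoord : Sphere 2 → Sphere 2 :=
  sphereMap (LinearIsometryEquiv.piLpCongrLeft 2 ℝ ℝ (Equiv.swap 0 1))

/-- Multiplication of the first coordinate by a sign. -/
def flipCoord (s : ℤˣ) : Sphere 2 → Sphere 2 :=
  sphereMap (LinearIsometryEquiv.piLpCongrRight 2 fun i =>
    if i = 0 ∧ s ≠ 1 then LinearIsometryEquiv.neg ℝ else LinearIsometryEquiv.refl ℝ ℝ)

@[simp] theorem swapCoord_zero (x : Sphere 2) :
    (swapCoord x : EuclideanSpace ℝ (Fin 2)) 0 = (x : EuclideanSpace ℝ (Fin 2)) 1 := by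
  simp [swapCoord, sphereMap, LinearIsometryEquiv.piLpCongrLeft_apply, Equiv.piCongrLeft']

@[simp] theorem swapCoord_one (x : Sphere 2) :
    (swapCoord x : EuclideanSpace ℝ (Fin 2)) 1 = (x : EuclideanSpace ℝ (Fin 2)) 0 := by
  simp [swapCoord, sphereMap, LinearIsometryEquiv.piLpCongrLeft_apply, Equiv.piCongrLeft']

@[simp] theorem flipCoord_zero (s : ℤˣ) (x : Sphere 2) :
    (flipCoord s x : EuclideanSpace ℝ (Fin 2)) 0 =
      ((s : ℤ) : ℝ) * (x : EuclideanSpace ℝ (Fin 2)) 0 := by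
  rcases Int.units_eq_one_or s with rfl | rfl <;> simp [flipCoord, sphereMap]

@[simp] theorem flipCoord_one (s : ℤˣ) (x : Sphere 2) :
    (flipCoord s x : EuclideanSpace ℝ (Fin 2)) 1 = (x : EuclideanSpace ℝ (Fin 2)) 1 := by
  simp [flipCoord, sphereMap]

theorem measurePreserving_swapCoord :
    MeasurePreserving swapCoord (uniformSphere 2) (uniformSphere 2) :=
  measurePreserving_sphereMap _

theorem measurePreserving_flipCoord (s : ℤˣ) :
    MeasurePreserving (flipCoord s) (uniformSphere 2) (uniformSphere 2) :=
  measurePreserving_sphereMap _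

theorem spinInner_eq (x y : Sphere 2) :
    (spinInner x y : ℝ) = (x : EuclideanSpace ℝ (Fin 2)) 0 * (y : EuclideanSpace ℝ (Fin 2)) 0 +
      (x : EuclideanSpace ℝ (Fin 2)) 1 * (y : EuclideanSpace ℝ (Fin 2)) 1 := by
  simp [spinInner, PiLp.inner_apply, Fin.sum_univ_two, mul_comm]

theorem sphere_sq_add_sq (x : Sphere 2) :
    (x : EuclideanSpace ℝ (Fin 2)) 0 ^ 2 + (x : EuclideanSpace ℝ (Fin 2)) 1 ^ 2 = 1 := by
  have := EuclideanSpace.norm_sq_eq (x : EuclideanSpace ℝ (Fin 2))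
  rw [norm_eq_of_mem_sphere x, Fin.sum_univ_two] at this
  simpa using this.symm

theorem spinInner_self (x : Sphere 2) : (spinInner x x : ℝ) = 1 := by
  rw [spinInner_eq, ← pow_two, ← pow_two]
  exact sphere_sq_add_sq x

/-- Two unit vectors at angle at most `π / 4` from a third one have non-negative inner product. -/
theorem spinInner_nonneg_of_common {u v w : Sphere 2} (h1 : 1 / √2 ≤ (spinInner u w : ℝ))
    (h2 : 1 / √2 ≤ (spinInner w v : ℝ)) : 0 ≤ (spinInner u v : ℝ) := by
  have hc : (1 / √2) ^ 2 = (1 / 2 : ℝ) := by rw [div_pow, Real.sq_sqrt (by norm_num)]; norm_num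
  have hc0 : 0 ≤ 1 / √2 := by positivity
  have eu := sphere_sq_add_sq u
  have ev := sphere_sq_add_sq v
  have ew := sphere_sq_add_sq w
  rw [spinInner_eq] at *
  generalize 1 / √2 = c at *
  generalize (u : EuclideanSpace ℝ (Fin 2)) 0 = a at *
  generalize (u : EuclideanSpace ℝ (Fin 2)) 1 = b at *
  generalize (v : EuclideanSpace ℝ (Fin 2)) 0 = a' at *
  generalize (v : EuclideanSpace ℝ (Fin 2)) 1 = b' at *
  generalize (w : EuclideanSpace ℝ (Fin 2)) 0 = p at *
  generalize (w : EuclideanSpace ℝ (Fin 2)) 1 = q at *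
  -- `k1`, `k2` are Pythagoras and `k3` the addition formula for the angles at `w`. The product of
  -- the cosines is at least `1 / 2`, while each squared sine is at most `1 / 2`.
  have k1 : (a * p + b * q) ^ 2 + (a * q - b * p) ^ 2 = 1 := by
    linear_combination (p ^ 2 + q ^ 2) * eu + ew
  have k2 : (p * a' + q * b') ^ 2 + (a' * q - b' * p) ^ 2 = 1 := by
    linear_combination (p ^ 2 + q ^ 2) * ev + ew
  have k3 : a * a' + b * b' =
      (a * p + b * q) * (p * a' + q * b') + (a * q - b * p) * (a' * q - b' * p) := by
    linear_combination (-(a * a' + b * b')) * ew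
  have k4 : c * c ≤ (a * p + b * q) * (p * a' + q * b') := mul_le_mul h1 h2 hc0 (hc0.trans h1)
  have k5 : c ^ 2 ≤ (a * p + b * q) ^ 2 := pow_le_pow_left₀ hc0 h1 2
  have k6 : c ^ 2 ≤ (p * a' + q * b') ^ 2 := pow_le_pow_left₀ hc0 h2 2
  nlinarith [sq_nonneg ((a * q - b * p) + (a' * q - b' * p))]

/-- The product of the first coordinates has the larger modulus, so it decides the sign of the inner
product. -/
theorem mul_pos_of_spinInner_nonneg {u v : Sphere 2} (h : 0 ≤ (spinInner u v : ℝ))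
    (hu : (u : EuclideanSpace ℝ (Fin 2)) 1 ^ 2 < (u : EuclideanSpace ℝ (Fin 2)) 0 ^ 2)
    (hv : (v : EuclideanSpace ℝ (Fin 2)) 1 ^ 2 < (v : EuclideanSpace ℝ (Fin 2)) 0 ^ 2) :
    0 < (u : EuclideanSpace ℝ (Fin 2)) 0 * (v : EuclideanSpace ℝ (Fin 2)) 0 := by
  rw [spinInner_eq] at h
  by_contra! hneg
  have h1 := mul_lt_mul'' (sq_lt_sq.1 hu) (sq_lt_sq.1 hv) (abs_nonneg _) (abs_nonneg _)
  rw [← abs_mul, ← abs_mul, abs_of_nonpos hneg] at h1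
  have := le_abs_self
    ((u : EuclideanSpace ℝ (Fin 2)) 1 * (v : EuclideanSpace ℝ (Fin 2)) 1)
  linarith

theorem half_le_mul_of_pos {u v : Sphere 2}
    (h : 0 < (u : EuclideanSpace ℝ (Fin 2)) 0 * (v : EuclideanSpace ℝ (Fin 2)) 0)
    (hu : (u : EuclideanSpace ℝ (Fin 2)) 1 ^ 2 ≤ (u : EuclideanSpace ℝ (Fin 2)) 0 ^ 2)
    (hv : (v : EuclideanSpace ℝ (Fin 2)) 1 ^ 2 ≤ (v : EuclideanSpace ℝ (Fin 2)) 0 ^ 2) :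
    1 / 2 ≤ (u : EuclideanSpace ℝ (Fin 2)) 0 * (v : EuclideanSpace ℝ (Fin 2)) 0 := by
  have eu := sphere_sq_add_sq u
  have ev := sphere_sq_add_sq v
  refine le_of_sq_le_sq ?_ h.le
  nlinarith

/-! ### Griffiths' first inequality -/

/-- Ferromagnetic observables: sums of products of non-negative constants and signed spins. -/
def ferromagnetic {V : Type*} (a : V → ℝ) : Subsemiring ((V → ℤˣ) → ℝ) :=
  Subsemiring.closure ({f | ∃ c : ℝ, 0 ≤ c ∧ f = fun _ => c} ∪
    {f | ∃ v, f = fun s => ((s v : ℤ) : ℝ) * a v})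

theorem const_mem_ferromagnetic {V : Type*} (a : V → ℝ) {c : ℝ} (hc : 0 ≤ c) :
    (fun _ => c) ∈ ferromagnetic a :=
  Subsemiring.subset_closure (.inl ⟨c, hc, rfl⟩)

theorem spin_mem_ferromagnetic {V : Type*} (a : V → ℝ) (v : V) :
    (fun s => ((s v : ℤ) : ℝ) * a v) ∈ ferromagnetic a :=
  Subsemiring.subset_closure (.inr ⟨v, rfl⟩)

/-- Elements of the semiring are sums of monomials with non-negative coefficients. Summing a
monomial over all signs factorises over the vertices: odd exponents cancel and even ones give
non-negative factors. -/
theorem sum_nonneg_of_mem_ferromagnetic {V : Type*} [Fintype V] [DecidableEq V] (a : V → ℝ)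
    {f : (V → ℤˣ) → ℝ} (hf : f ∈ ferromagnetic a) : 0 ≤ ∑ s, f s := by
  have mono : ∀ g ∈ Submonoid.closure ({f | ∃ c : ℝ, 0 ≤ c ∧ f = fun _ => c} ∪
      {f | ∃ v, f = fun s => ((s v : ℤ) : ℝ) * a v} : Set ((V → ℤˣ) → ℝ)),
      ∃ c : ℝ, 0 ≤ c ∧ ∃ n : V → ℕ, g = fun s => c * ∏ v, (((s v : ℤ) : ℝ) * a v) ^ n v := by
    intro g hg
    induction hg using Submonoid.closure_induction with
    | mem g hg =>
      rcases hg with ⟨c, hc, rfl⟩ | ⟨v, rfl⟩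
      · exact ⟨c, hc, 0, by simp⟩
      · refine ⟨1, zero_le_one, Pi.single v 1, ?_⟩
        ext s
        rw [one_mul, Finset.prod_eq_single v (fun w _ hw => by simp [hw]) (by simp)]
        simp
    | one => exact ⟨1, zero_le_one, 0, by ext; simp⟩
    | mul g h _ _ hg hh =>
      obtain ⟨c, hc, n, rfl⟩ := hg
      obtain ⟨d, hd, m, rfl⟩ := hh
      refine ⟨c * d, mul_nonneg hc hd, n + m, ?_⟩
      ext s
      simp only [Pi.mul_apply, Pi.add_apply, pow_add, Finset.prod_mul_distrib]
      ring
  rw [ferromagnetic, Subsemiring.mem_closure_iff] at hf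
  induction hf using AddSubmonoid.closure_induction with
  | mem g hg =>
    obtain ⟨c, hc, n, rfl⟩ := mono g hg
    rw [← Finset.mul_sum, ← Fintype.prod_sum (fun v (ε : ℤˣ) => (((ε : ℤ) : ℝ) * a v) ^ n v)]
    refine mul_nonneg hc (Finset.prod_nonneg fun v _ => ?_)
    have hu : (Finset.univ : Finset ℤˣ) = {1, -1} := rfl
    rw [hu, Finset.sum_pair (by decide)]
    rcases Nat.even_or_odd (n v) with h | h
    · exact add_nonneg (h.pow_nonneg _) (h.pow_nonneg _)
    · simp [h.neg_pow]
  | zero => simp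
  | add g h _ _ hg hh =>
    simp only [Pi.add_apply, Finset.sum_add_distrib]
    exact add_nonneg hg hh

/-- Every function of a single sign is affine; monotonicity makes the slope non-negative. This turns
arbitrary monotone edge weights into ferromagnetic ones. -/
theorem exists_affine_of_monotone {g : ℝ → ℝ} (hg : Monotone g) (h0 : ∀ x, 0 ≤ g x) (t c : ℝ) :
    ∃ α β : ℝ, 0 ≤ α ∧ 0 ≤ β ∧ ∀ ε : ℤˣ, g (((ε : ℤ) : ℝ) * t + c) =
      α + β * (((ε : ℤ) : ℝ) * t) := by
  rcases eq_or_ne t 0 with rfl | ht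
  · exact ⟨g c, 0, h0 _, le_rfl, by simp⟩
  · refine ⟨(g (t + c) + g (-t + c)) / 2, (g (t + c) - g (-t + c)) / (2 * t), ?_, ?_, ?_⟩
    · have := h0 (t + c)
      have := h0 (-t + c)
      positivity
    · rcases ht.lt_or_gt with h | h
      · refine div_nonneg_of_nonpos ?_ (by linarith)
        exact sub_nonpos.2 (hg (by linarith))
      · exact div_nonneg (sub_nonneg.2 (hg (by linarith))) (by linarith)
    · intro ε
      rcases Int.units_eq_one_or ε with rfl | rfl
      · push_cast
        rw [one_mul]
        field_simp
        ring
      · push_cast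
        rw [neg_one_mul]
        field_simp
        ring

/-! ### The density of the spin model -/

theorem expNeg_add (a b : WithTop ℝ) : expNeg (a + b) = expNeg a * expNeg b := by
  induction a with
  | top => simp [expNeg]
  | coe a =>
    induction b with
    | top => simp [expNeg]
    | coe b =>
      rw [← WithTop.coe_add]
      simp only [expNeg]
      rw [neg_add, Real.exp_add, ENNReal.ofReal_mul (Real.exp_pos _).le]

theorem expNeg_sum {ι : Type*} (s : Finset ι) (f : ι → WithTop ℝ) :
    expNeg (∑ i ∈ s, f i) = ∏ i ∈ s, expNeg (f i) := by
  classical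
  induction s using Finset.induction_on with
  | empty => simp [expNeg, ← WithTop.coe_zero]
  | insert i s hi ih => rw [Finset.sum_insert hi, Finset.prod_insert hi, expNeg_add, ih]

theorem expNeg_antitone : Antitone expNeg := by
  intro a b h
  induction b with
  | top => simp [expNeg]
  | coe b =>
    induction a with
    | top => simp at h
    | coe a =>
      have := WithTop.coe_le_coe.1 h
      exact ENNReal.ofReal_le_ofReal (Real.exp_le_exp.2 (by linarith))

theorem expNeg_ne_top (a : WithTop ℝ) : expNeg a ≠ ∞ := by
  induction a <;> simp [expNeg]

theorem expNeg_eq_zero {a : WithTop ℝ} : expNeg a = 0 ↔ a = ⊤ := by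
  induction a <;> simp [expNeg, Real.exp_pos]

/-- The density of the spin model with respect to the product measure. -/
def density {V : Type*} [Fintype V] (G : SimpleGraph V) {n : ℕ}
    (U : Set.Icc (-1 : ℝ) 1 → WithTop ℝ) (σ : V → Sphere n) : ℝ≥0∞ :=
  expNeg (energy G U σ)

/-- The factor of the density that belongs to an edge. -/
def edgeDensity {V : Type*} {n : ℕ} (U : Set.Icc (-1 : ℝ) 1 → WithTop ℝ) (σ : V → Sphere n)
    (e : Sym2 V) : ℝ≥0∞ :=
  expNeg (Sym2.lift ⟨fun u v => U (spinInner (σ u) (σ v)),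
      fun u v => congrArg U (spinInner_comm (σ u) (σ v))⟩ e)

theorem continuous_spinInner {n : ℕ} {ι : Type*} (u v : ι) :
    Continuous fun σ : ι → Sphere n => spinInner (σ u) (σ v) :=
  Continuous.subtype_mk (by fun_prop) _

section Density

variable {V : Type*} [Fintype V] (G : SimpleGraph V) {n : ℕ}
  {U : Set.Icc (-1 : ℝ) 1 → WithTop ℝ}

open Classical in
theorem density_eq_prod (σ : V → Sphere n) :
    density G U σ = ∏ e ∈ G.edgeFinset, edgeDensity U σ e := by
  rw [density, energy, expNeg_sum]
  rfl

theorem density_ne_top (σ : V → Sphere n) : density G U σ ≠ ∞ := expNeg_ne_top _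

theorem potential_ne_top_of_adj {σ : V → Sphere n} (h : density G U σ ≠ 0) {u v : V}
    (huv : G.Adj u v) : U (spinInner (σ u) (σ v)) ≠ ⊤ := by
  classical
  rw [density_eq_prod, Finset.prod_ne_zero_iff] at h
  have := h s(u, v) (by simpa using huv)
  rwa [edgeDensity, Sym2.lift_mk, Ne, expNeg_eq_zero] at this

/-- Monotonicity of `expNeg ∘ U` replaces any regularity assumption on `U`. -/
theorem measurable_density (hU : Antitone U) :
    Measurable (density G U : (V → Sphere n) → ℝ≥0∞) := by
  classical
  have h1 : (density G U : (V → Sphere n) → ℝ≥0∞) =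
      fun σ => ∏ e ∈ G.edgeFinset, edgeDensity U σ e := funext (density_eq_prod G)
  rw [h1]
  refine Finset.measurable_fun_prod _ fun e _ => ?_
  induction e using Sym2.ind with
  | _ u v =>
    have h2 : Measurable fun r => expNeg (U r) :=
      Monotone.measurable fun a b h => expNeg_antitone (hU h)
    have h3 : Measurable fun σ : V → Sphere n => spinInner (σ u) (σ v) :=
      (continuous_spinInner u v).measurable
    exact h2.comp h3

theorem density_le (hU : Antitone U) : ∃ C : ℝ≥0∞, C ≠ ∞ ∧
    ∀ σ : V → Sphere n, density G U σ ≤ C := by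
  classical
  refine ⟨∏ e ∈ G.edgeFinset, expNeg (U ⟨1, by norm_num⟩),
    ENNReal.prod_ne_top fun _ _ => expNeg_ne_top _, fun σ => ?_⟩
  rw [density_eq_prod]
  refine Finset.prod_le_prod' fun e _ => ?_
  induction e using Sym2.ind with
  | _ u v => exact expNeg_antitone (hU (Subtype.coe_le_coe.1 (spinInner (σ u) (σ v)).2.2))

theorem density_map (f : Sphere n → Sphere n)
    (hf : ∀ x y, spinInner (f x) (f y) = spinInner x y) (σ : V → Sphere n) :
    density G U (fun v => f (σ v)) = density G U σ := by
  simp only [density, energy, hf]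

/-- Flips fix the second coordinates, so an edge factor depends on the signs only through the
product `s u * s v`, in which it is affine with non-negative coefficients. -/
theorem density_flip_mem_ferromagnetic (hU : Antitone U) (σ : V → Sphere 2) :
    (fun s : V → ℤˣ => (density G U fun v => flipCoord (s v) (σ v)).toReal) ∈
      ferromagnetic fun v => (σ v : EuclideanSpace ℝ (Fin 2)) 0 := by
  classical
  have : (fun s : V → ℤˣ => (density G U fun v => flipCoord (s v) (σ v)).toReal) =
      ∏ e ∈ G.edgeFinset, fun s : V → ℤˣ =>
        (edgeDensity U (fun v => flipCoord (s v) (σ v)) e).toReal := by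
    ext s
    rw [density_eq_prod, ENNReal.toReal_prod, Finset.prod_apply]
  rw [this]
  refine Subsemiring.prod_mem _ fun e _ => ?_
  induction e using Sym2.ind with
  | _ u v =>
    let g : ℝ → ℝ := fun x => (expNeg (U (Set.projIcc (-1) 1 (by norm_num) x))).toReal
    have hg : Monotone g := fun x y h => ENNReal.toReal_mono (expNeg_ne_top _)
      (expNeg_antitone (hU (Set.monotone_projIcc _ h)))
    obtain ⟨α, β, hα, hβ, h⟩ := exists_affine_of_monotone hg (fun _ => ENNReal.toReal_nonneg)
      ((σ u : EuclideanSpace ℝ (Fin 2)) 0 * (σ v : EuclideanSpace ℝ (Fin 2)) 0)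
      ((σ u : EuclideanSpace ℝ (Fin 2)) 1 * (σ v : EuclideanSpace ℝ (Fin 2)) 1)
    have key : (fun s : V → ℤˣ =>
        (edgeDensity U (fun v => flipCoord (s v) (σ v)) s(u, v)).toReal) =
        (fun _ => α) + (fun _ => β) *
          ((fun s => ((s u : ℤ) : ℝ) * (σ u : EuclideanSpace ℝ (Fin 2)) 0) *
            fun s => ((s v : ℤ) : ℝ) * (σ v : EuclideanSpace ℝ (Fin 2)) 0) := by
      ext s
      have h2 := h (s u * s v)
      have h3 : edgeDensity U (fun v => flipCoord (s v) (σ v)) s(u, v) =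
        expNeg (U (Set.projIcc (-1) 1 (by norm_num)
          (spinInner (flipCoord (s u) (σ u)) (flipCoord (s v) (σ v)) : ℝ))) := by
        rw [Set.projIcc_val]
        rfl
      rw [h3, spinInner_eq]
      simp only [flipCoord_zero, flipCoord_one, Pi.add_apply, Pi.mul_apply]
      simp only [g, Units.val_mul, Int.cast_mul] at h2
      convert h2 using 1
      · congr 5
        ring
      · ring
    rw [key]
    exact add_mem (const_mem_ferromagnetic _ hα) (mul_mem (const_mem_ferromagnetic _ hβ)
      (mul_mem (spin_mem_ferromagnetic _ u) (spin_mem_ferromagnetic _ v)))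

theorem sum_flip_nonneg [DecidableEq V] (hU : Antitone U) (σ : V → Sphere 2) (x y : V) :
    0 ≤ ∑ s : V → ℤˣ, (flipCoord (s x) (σ x) : EuclideanSpace ℝ (Fin 2)) 0 *
      (flipCoord (s y) (σ y) : EuclideanSpace ℝ (Fin 2)) 0 *
        (density G U fun v => flipCoord (s v) (σ v)).toReal := by
  have := sum_nonneg_of_mem_ferromagnetic _ (mul_mem (mul_mem
    (spin_mem_ferromagnetic (fun v => (σ v : EuclideanSpace ℝ (Fin 2)) 0) x)
    (spin_mem_ferromagnetic (fun v => (σ v : EuclideanSpace ℝ (Fin 2)) 0) y))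
    (density_flip_mem_ferromagnetic G hU σ))
  simpa using this

end Density

/-! ### The spin measure -/

section SpinMeasure

variable {V : Type*} [Fintype V] (G : SimpleGraph V) {U : Set.Icc (-1 : ℝ) 1 → WithTop ℝ}

/-- The product of the uniform measures. -/
abbrev freeMeasure (V : Type*) [Fintype V] : Measure (V → Sphere 2) :=
  Measure.pi fun _ => uniformSphere 2

theorem exists_ball_pos (ε : ℝ) (hε : 0 < ε) :
    ∃ x : Sphere 2, 0 < uniformSphere 2 (Metric.ball x ε) := by
  by_contra! h
  have : uniformSphere 2 Set.univ = 0 := by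
    refine measure_null_of_locally_null _ fun x _ =>
      ⟨Metric.ball x ε, ?_, le_antisymm (h x) (by simp)⟩
    rw [nhdsWithin_univ]
    exact Metric.ball_mem_nhds x hε
  simp at this

theorem le_spinInner_of_dist {n : ℕ} (x y : Sphere n) :
    1 - dist x y ^ 2 / 2 ≤ (spinInner x y : ℝ) := by
  have h := norm_sub_sq_real (x : EuclideanSpace ℝ (Fin n)) y
  rw [norm_eq_of_mem_sphere x, norm_eq_of_mem_sphere y, ← dist_eq_norm, ← Subtype.dist_eq] at h
  have : (spinInner x y : ℝ) = inner ℝ (x : EuclideanSpace ℝ (Fin n)) y := rfl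
  rw [this]
  linarith

theorem partitionFunction_ne_zero (hU : Antitone U)
    (hU_ne : ∃ r : Set.Icc (-1 : ℝ) 1, (r : ℝ) < 1 ∧ U r ≠ ⊤) : partitionFunction G 2 U ≠ 0 := by
  classical
  obtain ⟨r, hr, hUr⟩ := hU_ne
  -- Two spins in a ball of this radius are less than `√(1 - r)` apart, so their inner product
  -- exceeds `(1 + r) / 2 > r` and every edge has finite energy.
  obtain ⟨x, hx⟩ := exists_ball_pos (√(1 - r) / 2) (by
    have : 0 < 1 - (r : ℝ) := by linarith
    positivity)
  intro h
  have h0 : density G U =ᵐ[freeMeasure V] 0 :=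
    (lintegral_eq_zero_iff (measurable_density G hU)).1 h
  have h1 : freeMeasure V (Set.univ.pi fun _ => Metric.ball x (√(1 - r) / 2)) = 0 := by
    refine measure_mono_null (fun σ hσ => ?_) h0
    have hin : ∀ u v, r ≤ spinInner (σ u) (σ v) := by
      intro u v
      have h2 : dist (σ u) (σ v) < √(1 - r) := by
        have := dist_triangle_right (σ u) (σ v) x
        have a1 := Metric.mem_ball.1 (hσ u trivial)
        have a2 := Metric.mem_ball.1 (hσ v trivial)
        linarith
      have h3 : dist (σ u) (σ v) ^ 2 < 1 - r := (Real.lt_sqrt dist_nonneg).1 h2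
      have h4 := le_spinInner_of_dist (σ u) (σ v)
      exact Subtype.coe_le_coe.1 (by linarith)
    change ¬ (density G U σ = 0)
    rw [density_eq_prod, Finset.prod_eq_zero_iff]
    rintro ⟨e, -, he⟩
    induction e using Sym2.ind with
    | _ u v =>
      rw [edgeDensity, Sym2.lift_mk, expNeg_eq_zero] at he
      exact hUr (top_le_iff.1 (he ▸ hU (hin u v)))
  rw [Measure.pi_pi, Finset.prod_eq_zero_iff] at h1
  obtain ⟨_, -, h1⟩ := h1
  exact hx.ne' h1

theorem partitionFunction_ne_top (hU : Antitone U) : partitionFunction G 2 U ≠ ∞ := by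
  obtain ⟨C, hC, h⟩ := density_le (n := 2) G hU
  refine ne_top_of_le_ne_top ?_ (lintegral_mono (μ := freeMeasure V) h)
  simpa using hC

theorem spinMeasure_eq : spinMeasure G 2 U =
    (partitionFunction G 2 U)⁻¹ • (freeMeasure V).withDensity (density G U) := rfl

theorem isProbabilityMeasure_spinMeasure (hU : Antitone U)
    (hU_ne : ∃ r : Set.Icc (-1 : ℝ) 1, (r : ℝ) < 1 ∧ U r ≠ ⊤) :
    IsProbabilityMeasure (spinMeasure G 2 U) := by
  constructor
  rw [spinMeasure_eq, Measure.smul_apply, withDensity_apply _ .univ, Measure.restrict_univ]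
  exact ENNReal.inv_mul_cancel (partitionFunction_ne_zero G hU hU_ne)
    (partitionFunction_ne_top G hU)

theorem ae_spinMeasure_density_ne_zero (hU : Antitone U) :
    ∀ᵐ σ ∂(spinMeasure G 2 U), density G U σ ≠ 0 := by
  rw [spinMeasure_eq]
  refine Measure.ae_smul_measure ?_ _
  rw [ae_withDensity_iff (measurable_density G hU)]
  exact .of_forall fun _ h => h

theorem ae_spinMeasure_generic :
    ∀ᵐ σ ∂(spinMeasure G 2 U), ∀ v, (σ v : EuclideanSpace ℝ (Fin 2)) 0 ^ 2 ≠
      (σ v : EuclideanSpace ℝ (Fin 2)) 1 ^ 2 := by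
  rw [spinMeasure_eq]
  refine Measure.ae_smul_measure ((withDensity_absolutelyContinuous _ _).ae_le ?_) _
  refine Filter.eventually_all.2 fun v => ?_
  exact (measurePreserving_eval (fun _ : V => uniformSphere 2) v).quasiMeasurePreserving.ae
    (p := fun x : Sphere 2 => (x : EuclideanSpace ℝ (Fin 2)) 0 ^ 2 ≠
      (x : EuclideanSpace ℝ (Fin 2)) 1 ^ 2)
    (measure_mono_null (fun x hx => not_not.1 hx) uniformSphere_diagonal)

theorem setIntegral_spinMeasure (hU : Antitone U) {A : Set (V → Sphere 2)}
    (hA : MeasurableSet A) (f : (V → Sphere 2) → ℝ) :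
    ∫ σ in A, f σ ∂(spinMeasure G 2 U) = (partitionFunction G 2 U)⁻¹.toReal *
      ∫ σ in A, f σ * (density G U σ).toReal ∂(freeMeasure V) := by
  rw [spinMeasure_eq, Measure.restrict_smul, integral_smul_measure, smul_eq_mul,
    restrict_withDensity hA, integral_withDensity_eq_integral_toReal_smul (measurable_density G hU)
      (.of_forall fun σ => (density_ne_top G σ).lt_top)]
  simp only [smul_eq_mul, mul_comm]

theorem measurePreserving_swap (hU : Antitone U) :
    MeasurePreserving (fun (σ : V → Sphere 2) v => swapCoord (σ v)) (spinMeasure G 2 U)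
      (spinMeasure G 2 U) := by
  have hT : MeasurePreserving (fun (σ : V → Sphere 2) v => swapCoord (σ v)) (freeMeasure V)
      (freeMeasure V) := measurePreserving_pi _ _ fun _ => measurePreserving_swapCoord
  refine ⟨hT.measurable, ?_⟩
  ext A hA
  rw [Measure.map_apply hT.measurable hA, spinMeasure_eq, Measure.smul_apply, Measure.smul_apply,
    withDensity_apply _ (hT.measurable hA), withDensity_apply _ hA,
    ← hT.setLIntegral_comp_preimage hA (measurable_density G hU)]
  congr 1
  refine lintegral_congr fun σ => (density_map G _ (fun x y => Subtype.ext ?_) σ).symm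
  rw [spinInner_eq, spinInner_eq]
  simp [add_comm]

theorem measurable_spin_coord (v : V) (i : Fin 2) :
    Measurable fun σ : V → Sphere 2 => (σ v : EuclideanSpace ℝ (Fin 2)) i :=
  Continuous.measurable (by fun_prop)

theorem abs_coord_le (x : Sphere 2) (i : Fin 2) : |(x : EuclideanSpace ℝ (Fin 2)) i| ≤ 1 :=
  (PiLp.norm_apply_le (x : EuclideanSpace ℝ (Fin 2)) i).trans (norm_eq_of_mem_sphere x).le

theorem integrable_coord_mul (μ : Measure (V → Sphere 2)) [IsFiniteMeasure μ] (x y : V)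
    (i : Fin 2) : Integrable (fun σ : V → Sphere 2 => (σ x : EuclideanSpace ℝ (Fin 2)) i *
      (σ y : EuclideanSpace ℝ (Fin 2)) i) μ := by
  refine Integrable.of_bound
    ((measurable_spin_coord x i).mul (measurable_spin_coord y i)).aestronglyMeasurable 1
    (.of_forall fun σ => ?_)
  rw [Real.norm_eq_abs, abs_mul]
  exact mul_le_one₀ (abs_coord_le _ _) (abs_nonneg _) (abs_coord_le _ _)

theorem correlation_eq (hU : Antitone U)
    (hU_ne : ∃ r : Set.Icc (-1 : ℝ) 1, (r : ℝ) < 1 ∧ U r ≠ ⊤) (x y : V) :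
    correlation G 2 U x y = 2 * ∫ σ, (σ x : EuclideanSpace ℝ (Fin 2)) 0 *
      (σ y : EuclideanSpace ℝ (Fin 2)) 0 ∂(spinMeasure G 2 U) := by
  have := isProbabilityMeasure_spinMeasure G hU hU_ne
  rw [correlation]
  simp only [spinInner_eq]
  rw [integral_add (integrable_coord_mul _ x y 0) (integrable_coord_mul _ x y 1), two_mul]
  congr 1
  have hT := measurePreserving_swap G hU
  have := integral_map (μ := spinMeasure G 2 U) hT.measurable.aemeasurable
    (f := fun σ => (σ x : EuclideanSpace ℝ (Fin 2)) 0 * (σ y : EuclideanSpace ℝ (Fin 2)) 0)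
    ((measurable_spin_coord x 0).mul (measurable_spin_coord y 0)).aestronglyMeasurable
  rw [hT.map_eq] at this
  rw [this]
  simp

theorem setIntegral_flip_invariant_nonneg (hU : Antitone U) {A : Set (V → Sphere 2)}
    (hA : MeasurableSet A)
    (hflip : ∀ (s : V → ℤˣ) σ, (fun v => flipCoord (s v) (σ v)) ∈ A ↔ σ ∈ A) (x y : V) :
    0 ≤ ∫ σ in A, (σ x : EuclideanSpace ℝ (Fin 2)) 0 * (σ y : EuclideanSpace ℝ (Fin 2)) 0
      ∂(spinMeasure G 2 U) := by
  classical
  rw [setIntegral_spinMeasure G hU hA]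
  refine mul_nonneg ENNReal.toReal_nonneg ?_
  rw [← integral_indicator hA]
  set F : (V → Sphere 2) → ℝ := A.indicator fun σ => (σ x : EuclideanSpace ℝ (Fin 2)) 0 *
    (σ y : EuclideanSpace ℝ (Fin 2)) 0 * (density G U σ).toReal with hF
  have hFm : Measurable F := (((measurable_spin_coord x 0).mul (measurable_spin_coord y 0)).mul
    (measurable_density G hU).ennreal_toReal).indicator hA
  have hT : ∀ s : V → ℤˣ, MeasurePreserving (fun (σ : V → Sphere 2) v => flipCoord (s v) (σ v))
      (freeMeasure V) (freeMeasure V) := fun s =>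
    measurePreserving_pi _ _ fun v => measurePreserving_flipCoord (s v)
  obtain ⟨C, hC, hCle⟩ := density_le (n := 2) G hU
  have hFi : Integrable F (freeMeasure V) := by
    refine Integrable.of_bound hFm.aestronglyMeasurable C.toReal (.of_forall fun σ => ?_)
    refine (norm_indicator_le_norm_self _ _).trans ?_
    rw [Real.norm_eq_abs, abs_mul, abs_mul, abs_of_nonneg ENNReal.toReal_nonneg]
    refine (mul_le_of_le_one_left ENNReal.toReal_nonneg ?_).trans
      (ENNReal.toReal_mono hC (hCle σ))
    exact mul_le_one₀ (abs_coord_le _ _) (abs_nonneg _) (abs_coord_le _ _)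
  -- Flips preserve the product measure, so the integrand may be averaged over all sign choices; on
  -- each orbit this gives Griffiths' sum, or zero off `A`.
  have hsum : (Fintype.card (V → ℤˣ) : ℝ) * ∫ σ, F σ ∂(freeMeasure V) =
      ∫ σ, ∑ s : V → ℤˣ, F (fun v => flipCoord (s v) (σ v)) ∂(freeMeasure V) := by
    have hi : ∀ s : V → ℤˣ, Integrable (fun σ => F fun v => flipCoord (s v) (σ v))
        (freeMeasure V) := fun s => (hT s).integrable_comp_of_integrable hFi
    rw [integral_finsetSum _ fun s _ => hi s]
    have : ∀ s : V → ℤˣ, ∫ σ, F (fun v => flipCoord (s v) (σ v)) ∂(freeMeasure V) =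
        ∫ σ, F σ ∂(freeMeasure V) := by
      intro s
      have := integral_map (μ := freeMeasure V) (hT s).measurable.aemeasurable (f := F)
        hFm.aestronglyMeasurable
      rw [(hT s).map_eq] at this
      exact this.symm
    simp [this]
  have hnn : 0 ≤ ∫ σ, ∑ s : V → ℤˣ, F (fun v => flipCoord (s v) (σ v)) ∂(freeMeasure V) := by
    refine integral_nonneg fun σ => ?_
    by_cases h : σ ∈ A
    · have := sum_flip_nonneg G hU σ x y
      refine this.trans_eq (Finset.sum_congr rfl fun s _ => ?_)
      rw [hF, Set.indicator_of_mem ((hflip s σ).2 h)]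
    · refine (Finset.sum_eq_zero fun s _ => ?_).ge
      exact Set.indicator_of_notMem (mt (hflip s σ).1 h) _
  rw [← hsum] at hnn
  exact nonneg_of_mul_nonneg_right hnn (Nat.cast_pos.2 Fintype.card_pos)

/-- If on a flip-invariant event the first coordinates at `x` and `y` have equal signs and
modulus at least `1 / √2`, then its probability is a lower bound for the correlation. -/
theorem measureReal_le_correlation (hU : Antitone U)
    (hU_ne : ∃ r : Set.Icc (-1 : ℝ) 1, (r : ℝ) < 1 ∧ U r ≠ ⊤) {A : Set (V → Sphere 2)}
    (hA : MeasurableSet A)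
    (hflip : ∀ (s : V → ℤˣ) σ, (fun v => flipCoord (s v) (σ v)) ∈ A ↔ σ ∈ A) (x y : V)
    (h : ∀ᵐ σ ∂(spinMeasure G 2 U), σ ∈ A → 1 / 2 ≤
      (σ x : EuclideanSpace ℝ (Fin 2)) 0 * (σ y : EuclideanSpace ℝ (Fin 2)) 0) :
    (spinMeasure G 2 U).real A ≤ correlation G 2 U x y := by
  have := isProbabilityMeasure_spinMeasure G hU hU_ne
  have hi := integrable_coord_mul (spinMeasure G 2 U) x y 0
  rw [correlation_eq G hU hU_ne, ← integral_add_compl hA hi]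
  -- The complement of `A` is flip-invariant as well, so it contributes a non-negative amount; the
  -- factor `2` in `correlation_eq` offsets the bound `1 / 2` on `A`.
  have h1 := setIntegral_flip_invariant_nonneg G hU hA.compl
    (fun s σ => not_congr (hflip s σ)) x y
  have h2 : ∫ _ in A, (1 / 2 : ℝ) ∂(spinMeasure G 2 U) ≤ ∫ σ in A,
      (σ x : EuclideanSpace ℝ (Fin 2)) 0 * (σ y : EuclideanSpace ℝ (Fin 2)) 0
      ∂(spinMeasure G 2 U) :=
    setIntegral_mono_on_ae (integrable_const _).integrableOn hi.integrableOn hA h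
  rw [setIntegral_const, smul_eq_mul] at h2
  linarith

end SpinMeasure

/-! ### Crossings in the spin model -/

/-- The first coordinate of the spin at `v` dominates the second one. -/
def Dominant {V : Type*} (σ : V → Sphere 2) (v : V) : Prop :=
  (σ v : EuclideanSpace ℝ (Fin 2)) 1 ^ 2 ≤ (σ v : EuclideanSpace ℝ (Fin 2)) 0 ^ 2

/-- The finite space of colourings is discrete, so crossing events are measurable whatever the path
structure. -/
theorem measurableSet_of_dominant {V : Type*} [Finite V] (P : (V → Prop) → Prop) :
    MeasurableSet {σ : V → Sphere 2 | P (Dominant σ)} := by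
  have hm : Measurable fun σ : V → Sphere 2 => Dominant σ := by
    refine measurable_pi_lambda _ fun v => measurableSet_setOfPred.1 ?_
    exact (isClosed_le (by fun_prop) (by fun_prop)).measurableSet
  exact hm (MeasurableSet.of_discrete (s := {c | P c}))

theorem dominant_flip {V : Type*} (s : V → ℤˣ) (σ : V → Sphere 2) :
    Dominant (fun v => flipCoord (s v) (σ v)) = Dominant σ := by
  ext v
  rcases Int.units_eq_one_or (s v) with h | h <;> simp [Dominant, h]

theorem dominant_swap {V : Type*} {σ : V → Sphere 2} {v : V} (h : ¬ Dominant σ v) :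
    Dominant (fun v => swapCoord (σ v)) v := by
  simpa [Dominant] using (not_le.1 h).le

section Torus

variable {L : ℕ} {U : Set.Icc (-1 : ℝ) 1 → WithTop ℝ}

/-- The event that two points of the square `[0, n]²` with its corners cut off are joined by a
path along which the first coordinate dominates. -/
def crossing (hL : 1 ≤ L) (n : ℕ) (p q : ℕ × ℕ) : Set (TorusVertex 2 L → Sphere 2) :=
  {σ | HexConn n (fun r => Dominant σ (gridVertex hL (cutCorner n r))) p q}

theorem le_spinInner_of_adj {V : Type*} [Fintype V] {G : SimpleGraph V}
    (hU_top : ∀ r : Set.Icc (-1 : ℝ) 1, (r : ℝ) < 1 / √2 → U r = ⊤) {σ : V → Sphere 2}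
    (h : density G U σ ≠ 0) {u v : V} (huv : u = v ∨ G.Adj u v) :
    1 / √2 ≤ (spinInner (σ u) (σ v) : ℝ) := by
  rcases huv with rfl | huv
  · rw [spinInner_self, div_le_one (by positivity)]
    exact Real.one_le_sqrt.2 (by norm_num)
  · by_contra! hlt
    exact potential_ne_top_of_adj G h huv (hU_top _ hlt)

theorem mul_pos_of_hexConn (hL : 1 ≤ L)
    (hU_top : ∀ r : Set.Icc (-1 : ℝ) 1, (r : ℝ) < 1 / √2 → U r = ⊤)
    {n : ℕ} (hn : 2 ≤ n) (hnL : n ≤ L) {σ : TorusVertex 2 L → Sphere 2}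
    (h : density (torus 2 L) U σ ≠ 0)
    (hgen : ∀ v, (σ v : EuclideanSpace ℝ (Fin 2)) 0 ^ 2 ≠ (σ v : EuclideanSpace ℝ (Fin 2)) 1 ^ 2)
    {p q : ℕ × ℕ}
    (hpq : HexConn n (fun r => Dominant σ (gridVertex hL (cutCorner n r))) p q) :
    0 < (σ (gridVertex hL (cutCorner n p)) : EuclideanSpace ℝ (Fin 2)) 0 *
      (σ (gridVertex hL (cutCorner n q)) : EuclideanSpace ℝ (Fin 2)) 0 := by
  have hdom : ∀ v, Dominant σ v →
      (σ v : EuclideanSpace ℝ (Fin 2)) 1 ^ 2 < (σ v : EuclideanSpace ℝ (Fin 2)) 0 ^ 2 :=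
    fun v hv => lt_of_le_of_ne hv (hgen v).symm
  have step : ∀ r s, HexEdge r s → r ≤ (n, n) → s ≤ (n, n) →
      Dominant σ (gridVertex hL (cutCorner n r)) → Dominant σ (gridVertex hL (cutCorner n s)) →
      0 < (σ (gridVertex hL (cutCorner n r)) : EuclideanSpace ℝ (Fin 2)) 0 *
        (σ (gridVertex hL (cutCorner n s)) : EuclideanSpace ℝ (Fin 2)) 0 := by
    intro r s hrs hr hs dr ds
    have hle : ((n, n) : ℕ × ℕ) ≤ (L, L) := ⟨hnL, hnL⟩
    obtain ⟨h1, h2, h3, h4⟩ := cutCorner_near hn hr hs hrs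
    obtain ⟨w, hw1, hw2⟩ := exists_common_neighbour hL _ _
      ((cutCorner_le (by omega) hr).trans hle) ((cutCorner_le (by omega) hs).trans hle) h1 h2 h3 h4
    exact mul_pos_of_spinInner_nonneg (spinInner_nonneg_of_common
      (le_spinInner_of_adj hU_top h hw1) (le_spinInner_of_adj hU_top h hw2))
      (hdom _ dr) (hdom _ ds)
  obtain ⟨hp, hpq⟩ := hpq
  induction hpq with
  | refl =>
    have := hdom _ hp
    rw [← pow_two]
    exact (sq_nonneg _).trans_lt this
  | @tail b c _ hst ih =>
    obtain ⟨hst, h1, h2, h3, h4⟩ := hst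
    have := hst.elim (fun hst => step _ _ hst h1 h2 h3 h4)
      (fun hst => mul_comm (G := ℝ) _ _ ▸ step _ _ hst h2 h1 h4 h3)
    -- The factor at the intermediate vertex `b` enters squared and drops out.
    have key := mul_pos ih this
    rw [mul_assoc, ← mul_assoc (_ : ℝ) _ ((σ (gridVertex hL (cutCorner n c)) :
      EuclideanSpace ℝ (Fin 2)) 0), ← pow_two, mul_left_comm] at key
    exact pos_of_mul_pos_right key (sq_nonneg _)

theorem crossing_le_correlation (hL : 1 ≤ L) (hU : Antitone U)
    (hU_top : ∀ r : Set.Icc (-1 : ℝ) 1, (r : ℝ) < 1 / √2 → U r = ⊤)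
    (hU_ne : ∃ r : Set.Icc (-1 : ℝ) 1, (r : ℝ) < 1 ∧ U r ≠ ⊤)
    {n : ℕ} (hn : 2 ≤ n) (hnL : n ≤ L) (p q : ℕ × ℕ) :
    (spinMeasure (torus 2 L) 2 U).real (crossing hL n p q) ≤ correlation (torus 2 L) 2 U
      (gridVertex hL (cutCorner n p)) (gridVertex hL (cutCorner n q)) := by
  refine measureReal_le_correlation _ hU hU_ne (measurableSet_of_dominant
    fun c => HexConn n (fun r => c (gridVertex hL (cutCorner n r))) p q) (fun s σ => ?_) _ _ ?_
  · simp only [Set.mem_ofPred_eq, dominant_flip]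
  · filter_upwards [ae_spinMeasure_density_ne_zero (torus 2 L) hU,
      ae_spinMeasure_generic (torus 2 L)] with σ h1 h2 h3
    exact half_le_mul_of_pos (mul_pos_of_hexConn hL hU_top hn hnL h1 h2 h3) h3.1
      (HexConn.right h3)

theorem one_le_sum_crossing (hL : 1 ≤ L) (hU : Antitone U)
    (hU_ne : ∃ r : Set.Icc (-1 : ℝ) 1, (r : ℝ) < 1 ∧ U r ≠ ⊤) {n : ℕ} (hn : 2 ≤ n) :
    1 ≤ ∑ j ∈ Finset.range n, ∑ j' ∈ Finset.range n,
        (spinMeasure (torus 2 L) 2 U).real (crossing hL n (0, j + 1) (n, j')) +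
      ∑ i ∈ Finset.range n, ∑ i' ∈ Finset.range n,
        (spinMeasure (torus 2 L) 2 U).real (crossing hL n (i, 0) (i' + 1, n)) := by
  have := isProbabilityMeasure_spinMeasure (torus 2 L) hU hU_ne
  have hT := measurePreserving_swap (torus 2 L) hU
  set μ := spinMeasure (torus 2 L) 2 U
  let T : (TorusVertex 2 L → Sphere 2) → TorusVertex 2 L → Sphere 2 := fun σ v => swapCoord (σ v)
  have hmeas : ∀ p q, μ.real (T ⁻¹' crossing hL n p q) = μ.real (crossing hL n p q) := fun p q =>
    hT.measureReal_preimage (measurableSet_of_dominant fun c =>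
      HexConn n (fun r => c (gridVertex hL (cutCorner n r))) p q).nullMeasurableSet
  -- The exchange `T` turns a vertical crossing of the other colour into a dominant one without
  -- changing probabilities.
  have hcov : (Set.univ : Set (TorusVertex 2 L → Sphere 2)) ⊆
      (⋃ j ∈ Finset.range n, ⋃ j' ∈ Finset.range n, crossing hL n (0, j + 1) (n, j')) ∪
      ⋃ i ∈ Finset.range n, ⋃ i' ∈ Finset.range n, T ⁻¹' crossing hL n (i, 0) (i' + 1, n) := by
    intro σ _
    simp only [Set.mem_union, Set.mem_iUnion, Finset.mem_range, exists_prop]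
    rcases exists_hexConn_cutCorner hn fun r => Dominant σ (gridVertex hL r) with
      ⟨j, hj, j', hj', h⟩ | ⟨j, hj, j', hj', h⟩
    · exact .inl ⟨j, hj, j', hj', h⟩
    · exact .inr ⟨j, hj, j', hj', HexConn.mono (fun r hr => dominant_swap hr) h⟩
  calc (1 : ℝ) = μ.real Set.univ := probReal_univ.symm
    _ ≤ _ := measureReal_mono hcov
    _ ≤ _ := measureReal_union_le _ _
    _ ≤ _ := by
      simp only [← hmeas (_, 0)]
      refine add_le_add ?_ ?_ <;>
      exact (measureReal_biUnion_finset_le _ _).trans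
        (Finset.sum_le_sum fun _ _ => measureReal_biUnion_finset_le _ _)

theorem exists_correlation_ge (hL : 1 ≤ L) (hU : Antitone U)
    (hU_top : ∀ r : Set.Icc (-1 : ℝ) 1, (r : ℝ) < 1 / √2 → U r = ⊤)
    (hU_ne : ∃ r : Set.Icc (-1 : ℝ) 1, (r : ℝ) < 1 ∧ U r ≠ ⊤) {n : ℕ} (hn : 2 ≤ n)
    (hnL : n ≤ L) : ∃ x y : TorusVertex 2 L, n ≤ (torus 2 L).dist x y ∧
      1 / (2 * (n : ℝ) ^ 2) ≤ correlation (torus 2 L) 2 U x y := by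
  by_contra! hcon
  have hle : ((n, n) : ℕ × ℕ) ≤ (L, L) := ⟨hnL, hnL⟩
  have hlt : ∀ p q : ℕ × ℕ, p ≤ (n, n) → q ≤ (n, n) →
      (n : ℤ) ≤ |((cutCorner n q).1 : ℤ) - (cutCorner n p).1| +
        |((cutCorner n q).2 : ℤ) - (cutCorner n p).2| →
      (spinMeasure (torus 2 L) 2 U).real (crossing hL n p q) < 1 / (2 * (n : ℝ) ^ 2) := by
    intro p q hp hq hpq
    refine (crossing_le_correlation hL hU hU_top hU_ne hn hnL p q).trans_lt (hcon _ _ ?_)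
    exact_mod_cast hpq.trans (le_torus_dist hL _ _ ((cutCorner_le (by omega) hp).trans hle)
      ((cutCorner_le (by omega) hq).trans hle))
  have hne : (Finset.range n).Nonempty := Finset.nonempty_range_iff.2 (by omega)
  have hn0 : (n : ℝ) ≠ 0 := by positivity
  -- Each of the two double sums has `n²` terms, so both stay below `1 / 2`, against a total of at
  -- least `1`.
  have hsum : ∀ F : ℕ → ℕ → ℝ, (∀ i < n, ∀ j < n, F i j < 1 / (2 * (n : ℝ) ^ 2)) →
      ∑ i ∈ Finset.range n, ∑ j ∈ Finset.range n, F i j < 1 / 2 := by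
    intro F hF
    calc ∑ i ∈ Finset.range n, ∑ j ∈ Finset.range n, F i j
        < ∑ i ∈ Finset.range n, ∑ j ∈ Finset.range n, 1 / (2 * (n : ℝ) ^ 2) :=
          Finset.sum_lt_sum_of_nonempty hne fun i hi => Finset.sum_lt_sum_of_nonempty hne
            fun j hj => hF i (Finset.mem_range.1 hi) j (Finset.mem_range.1 hj)
      _ = 1 / 2 := by
        simp only [Finset.sum_const, Finset.card_range, nsmul_eq_mul]
        field_simp
  have h1 := hsum (fun j j' => (spinMeasure (torus 2 L) 2 U).real
    (crossing hL n (0, j + 1) (n, j'))) fun j hj j' hj' =>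
      hlt _ _ ⟨by simp, hj⟩ ⟨le_rfl, hj'.le⟩ (cutCorner_left_right hn (by omega) hj')
  have h2 := hsum (fun i i' => (spinMeasure (torus 2 L) 2 U).real
    (crossing hL n (i, 0) (i' + 1, n))) fun i hi i' hi' =>
      hlt _ _ ⟨hi.le, by simp⟩ ⟨hi', le_rfl⟩ (cutCorner_bottom_top hn hi (by omega))
  linarith [one_le_sum_crossing hL hU hU_ne hn]

/-- Serves the case `ℓ = 1`, where the square is too small for its corners to be cut. -/
theorem half_le_correlation_of_adj {V : Type*} [Fintype V] (G : SimpleGraph V) (hU : Antitone U)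
    (hU_top : ∀ r : Set.Icc (-1 : ℝ) 1, (r : ℝ) < 1 / √2 → U r = ⊤)
    (hU_ne : ∃ r : Set.Icc (-1 : ℝ) 1, (r : ℝ) < 1 ∧ U r ≠ ⊤) {x y : V} (hxy : G.Adj x y) :
    1 / 2 ≤ correlation G 2 U x y := by
  have := isProbabilityMeasure_spinMeasure G hU hU_ne
  have hi : Integrable (fun σ : V → Sphere 2 => (spinInner (σ x) (σ y) : ℝ))
      (spinMeasure G 2 U) := by
    simp only [spinInner_eq]
    exact (integrable_coord_mul _ x y 0).add (integrable_coord_mul _ x y 1)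
  have h1 : (1 / 2 : ℝ) ≤ 1 / √2 :=
    one_div_le_one_div_of_le (by positivity) (Real.sqrt_le_iff.2 (by norm_num))
  have h2 : ∫ _, (1 / 2 : ℝ) ∂(spinMeasure G 2 U) ≤ correlation G 2 U x y := by
    refine integral_mono_ae (integrable_const _) hi ?_
    filter_upwards [ae_spinMeasure_density_ne_zero G hU] with σ h
    exact h1.trans (le_spinInner_of_adj hU_top h (.inr hxy))
  simpa using h2

end Torus

end SpinModel

end

/-! ### The lower bound at every scale and the failure of exponential decay. -/

theorem mainTheorem6 (U : Set.Icc (-1 : ℝ) 1 → WithTop ℝ) (hU : Antitone U)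
    (hU_top : ∀ r : Set.Icc (-1 : ℝ) 1, (r : ℝ) < 1 / √2 → U r = ⊤)
    (hU_ne : ∃ r : Set.Icc (-1 : ℝ) 1, (r : ℝ) < 1 ∧ U r ≠ ⊤) :
    (∀ L ℓ : ℕ, 1 ≤ ℓ → ℓ ≤ L →
      ∃ x y : SpinModel.TorusVertex 2 L, ℓ ≤ (SpinModel.torus 2 L).dist x y ∧
        1 / (2 * (ℓ : ℝ) ^ 2) ≤ SpinModel.correlation (SpinModel.torus 2 L) 2 U x y) ∧
    ¬ ∃ C c : ℝ, 0 < c ∧ ∀ (L : ℕ) (x y : SpinModel.TorusVertex 2 L),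
      SpinModel.correlation (SpinModel.torus 2 L) 2 U x y ≤
        C * Real.exp (-c * ((SpinModel.torus 2 L).dist x y : ℝ)) := by
  have main : ∀ L ℓ : ℕ, 1 ≤ ℓ → ℓ ≤ L →
      ∃ x y : SpinModel.TorusVertex 2 L, ℓ ≤ (SpinModel.torus 2 L).dist x y ∧
        1 / (2 * (ℓ : ℝ) ^ 2) ≤ SpinModel.correlation (SpinModel.torus 2 L) 2 U x y := by
    intro L ℓ hℓ hL
    rcases hℓ.eq_or_lt with rfl | hℓ
    · have hadj := SpinModel.gridVertex_adj_right hL (i := 0) (j := 0) (by simpa using hL)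
      refine ⟨_, _, (SimpleGraph.dist_eq_one_iff_adj.2 hadj).ge, ?_⟩
      have := SpinModel.half_le_correlation_of_adj _ hU hU_top hU_ne hadj
      simpa using this
    · exact SpinModel.exists_correlation_ge (by omega) hU hU_top hU_ne hℓ hL
  refine ⟨main, ?_⟩
  rintro ⟨C, c, hc, h⟩
  -- Taking `L = ℓ = n`, the polynomial bound beats the exponential one for large `n`; `|C|` is used
  -- since `C` may be negative.
  have hlim : Filter.Tendsto (fun n : ℕ => |C| * ((n : ℝ) ^ (2 : ℝ) * Real.exp (-c * n)))
      Filter.atTop (nhds (|C| * 0)) :=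
    ((tendsto_rpow_mul_exp_neg_mul_atTop_nhds_zero 2 c hc).comp
      tendsto_natCast_atTop_atTop).const_mul _
  rw [mul_zero] at hlim
  obtain ⟨n, hn, hn1⟩ := ((hlim.eventually_lt_const (show (0 : ℝ) < 1 / 2 by norm_num)).and
    (Filter.eventually_ge_atTop 1)).exists
  obtain ⟨x, y, hd, hcor⟩ := main n n hn1 le_rfl
  have hn0 : (0 : ℝ) < n := by exact_mod_cast hn1
  have h1 : 1 / (2 * (n : ℝ) ^ 2) ≤ |C| * Real.exp (-c * n) := by
    refine (hcor.trans (h n x y)).trans (mul_le_mul (le_abs_self C) (Real.exp_le_exp.2 ?_)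
      (Real.exp_pos _).le (abs_nonneg C))
    have : (n : ℝ) ≤ (SpinModel.torus 2 n).dist x y := by exact_mod_cast hd
    nlinarith
  rw [div_le_iff₀ (by positivity)] at h1
  rw [Real.rpow_two] at hn
  linarith
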